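/- Products and powers of linear orders are taken with the lexicographic order: for a linear order $L$ and an ordinal $\alpha$, $L^\alpha$ is the set of functions $\alpha\to L$, where $x<y$ iff $x(\beta)<y(\beta)$ at the least $\beta<\alpha$ at which $x$ and $y$ differ. Let $I=[0,1]$ be the real unit interval. The $I$-dimension of a linear order $X$ is the least ordinal $\alpha$ such that there is a strictly increasing function $X\to I^\alpha$; it is countable if it is smaller than $\omega_1$. Let $$\mathbb{L}^{\omega_1}=\{x\in[-1,1]^{\omega_1} : \{\alpha<\omega_1 : x(\alpha)\neq 0\}\text{ is countable}\},$$ with the order inherited from $[-1,1]^{\omega_1}$. **Proposition 8.** Let $X,Y\subseteq\mathbb{L}^{\omega_1}$ be subsets of countable $I$-dimension (with the induced orders). Then every order isomorphism $\varphi:X\to Y$ extends to an order automorphism of $\mathbb{L}^{\omega_1}$. In particular, every order isomorphism between two countable subsets of $\mathbb{L}^{\omega_1}$ extends to an order automorphism of $\mathbb{L}^{\omega_1}$; that is, $\mathbb{L}^{\omega_1}$ is homogeneous with respect to countable subsets. -/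

import Mathlib

open scoped Ordinal

universe u v

/-- The lexicographic power `L ^ α` of a linear order `L`, for an ordinal `α`: the functions from
`α` to `L`, compared at the least coordinate at which they differ. -/
abbrev LexPow (L : Type*) (α : Ordinal) : Type _ :=
  Lex (α.ToType → L)

/-- The dimension of `X` with respect to `L`: the least ordinal `α` such that there is a strictly
increasing function from `X` to `L ^ α`. -/
noncomputable def linDim (L : Type v) [LinearOrder L] (X : Type u) [LinearOrder X] : Ordinal.{u} :=
  sInf {α : Ordinal.{u} | ∃ f : X → LexPow L α, StrictMono f}

/-- If `L` has at least two points, the set of ordinals in the definition of `linDim` is not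
empty, so its infimum is a minimum. -/
theorem linDim_set_nonempty (L : Type v) [LinearOrder L] [Nontrivial L]
    (X : Type u) [LinearOrder X] :
    {α : Ordinal.{u} | ∃ f : X → LexPow L α, StrictMono f}.Nonempty := by
  classical
  obtain ⟨a, b, hab⟩ := exists_pair_lt L
  have hcard : Cardinal.mk (Cardinal.mk X).ord.ToType = Cardinal.mk X :=
    Cardinal.mk_ord_toType _
  obtain ⟨e⟩ := Cardinal.eq.1 hcard
  refine ⟨(Cardinal.mk X).ord, fun x => toLex (fun i => if e i ≤ x then b else a), ?_⟩
  intro x y hxy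
  have hne : {i | x < e i ∧ e i ≤ y}.Nonempty := ⟨e.symm y, by simpa using hxy⟩
  let m := wellFounded_lt.min {i | x < e i ∧ e i ≤ y} hne
  have hm : x < e m ∧ e m ≤ y := wellFounded_lt.min_mem _ hne
  refine ⟨m, fun j hj => ?_, ?_⟩
  · have hj' : ¬ (x < e j ∧ e j ≤ y) := fun h =>
      wellFounded_lt.not_lt_min {i | x < e i ∧ e i ≤ y} h hj
    by_cases h : e j ≤ x
    · simp [h, h.trans hxy.le]
    · have h2 : ¬ e j ≤ y := fun h2 => hj' ⟨not_le.1 h, h2⟩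
      simp [h, h2]
  · simpa [not_le.2 hm.1, hm.2] using hab

/-- The minimum in the definition of `linDim` is attained. -/
theorem exists_strictMono_linDim (L : Type v) [LinearOrder L] [Nontrivial L]
    (X : Type u) [LinearOrder X] : ∃ f : X → LexPow L (linDim L X), StrictMono f :=
  csInf_mem (linDim_set_nonempty L X)

/-- The `I`-dimension, where `I = [0, 1]` is the unit interval of the real line. -/
noncomputable abbrev iDim (X : Type u) [LinearOrder X] : Ordinal.{u} :=
  linDim unitInterval X

/-- The set of the elements of `[-1, 1] ^ ω₁` that have only countably many nonzero coordinates.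
As a type, it carries the order induced by the lexicographic order. -/
def LOmegaOne : Set (LexPow (Set.Icc (-1 : ℝ) 1) (ω₁ : Ordinal.{0})) :=
  {x | {α | (ofLex x α : ℝ) ≠ 0}.Countable}

/-- The interval `[-1, 1]`, the set of coordinates of `LOmegaOne`. -/
local notation "J" => Set.Icc (-1 : ℝ) 1

local instance fact_neg_one_le_one : Fact ((-1 : ℝ) ≤ 1) := ⟨by norm_num⟩

/-- The zero of `[-1, 1]`. -/
def iccZero : J := ⟨0, by norm_num, by norm_num⟩

/-- The least element of `[-1, 1]`. -/
def iccNegOne : J := ⟨-1, by norm_num, by norm_num⟩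

/-- The greatest element of `[-1, 1]`. -/
def iccOne : J := ⟨1, by norm_num, by norm_num⟩

theorem iccNegOne_lt_iccZero : iccNegOne < iccZero := by
  change (-1 : ℝ) < 0; norm_num

theorem iccZero_lt_iccOne : iccZero < iccOne := by
  change (0 : ℝ) < 1; norm_num

theorem exists_isLUB_lex {ι : Type} [LinearOrder ι] [WellFoundedLT ι] (S : Set (Lex (ι → J))) :
    ∃ s, IsLUB S s :=
  ⟨sSup S, isLUB_sSup S⟩

/-- A linear order embeds in a countable lexicographic power of `[-1, 1]`. -/
def HasCountableLexDim (Z : Type) [LinearOrder Z] : Prop :=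
  ∃ (ι : Type) (_ : LinearOrder ι) (_ : WellFoundedLT ι) (_ : Countable ι)
    (f : Z → Lex (ι → J)), StrictMono f

theorem HasCountableLexDim.of_strictMono {Z W : Type} [LinearOrder Z] [LinearOrder W]
    (h : HasCountableLexDim W) {g : Z → W} (hg : StrictMono g) : HasCountableLexDim Z := by
  obtain ⟨ι, i₁, i₂, i₃, f, hf⟩ := h
  exact ⟨ι, i₁, i₂, i₃, f ∘ g, hf.comp hg⟩

theorem HasCountableLexDim.of_subsingleton (Z : Type) [LinearOrder Z] [Subsingleton Z] :
    HasCountableLexDim Z :=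
  ⟨Empty, inferInstance, inferInstance, inferInstance, fun _ => toLex fun i => i.elim,
    fun x y h => absurd (Subsingleton.elim x y) h.ne⟩

theorem HasCountableLexDim.dual {Z : Type} [LinearOrder Z] (h : HasCountableLexDim Z) :
    HasCountableLexDim Zᵒᵈ := by
  obtain ⟨ι, i₁, i₂, i₃, f, hf⟩ := h
  refine ⟨ι, i₁, i₂, i₃, fun z => toLex fun i =>
    ⟨-(f (OrderDual.ofDual z) i : ℝ), by
      have := (f (OrderDual.ofDual z) i).2; constructor <;> linarith [this.1, this.2]⟩, ?_⟩
  intro x y hxy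
  obtain ⟨i, hi, hlt⟩ := hf (OrderDual.ofDual_lt_ofDual.2 hxy)
  refine ⟨i, fun j hj => Subtype.ext ?_, ?_⟩
  · have := congrArg Subtype.val (hi j hj)
    exact neg_inj.2 this.symm
  · exact neg_lt_neg (Subtype.coe_lt_coe.2 hlt)

/-- A set of countable dimension in `Z` yields a monotone map of `Z` into a countable
lexicographic power which separates the points of the set from all other points. -/
theorem exists_monotone_separating {Z : Type} [LinearOrder Z] (S : Set Z)
    (hS : HasCountableLexDim S) :
    ∃ (ι : Type) (_ : LinearOrder ι) (_ : WellFoundedLT ι) (_ : Countable ι)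
      (F : Z → Lex (ι → J)), Monotone F ∧ ∀ z z', z < z' → z ∈ S ∨ z' ∈ S → F z < F z' := by
  classical
  obtain ⟨ι, i₁, i₂, i₃, f, hf⟩ := hS
  choose g hg using fun z : Z => exists_isLUB_lex (f '' {x : S | (x : Z) ≤ z})
  let HasMax : Z → Prop := fun z => ∃ m : S, (m : Z) ≤ z ∧ ∀ x : S, (x : Z) ≤ z → x ≤ m
  let flag : Z → J := fun z => if z ∈ S then iccZero else if HasMax z then iccOne else iccNegOne
  let F : Z → Lex (WithTop ι → J) := fun z =>
    toLex fun o => WithTop.recTopCoe (C := fun _ => J) (flag z) (fun i => g z i) o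
  have hF1 : ∀ z z', g z < g z' → F z < F z' := by
    rintro z z' ⟨i, hi, hlt⟩
    refine ⟨(i : WithTop ι), fun o ho => ?_, hlt⟩
    induction o using WithTop.recTopCoe with
    | top => exact absurd ho (not_lt.2 le_top)
    | coe j => exact hi j (WithTop.coe_lt_coe.1 ho)
  have hF2 : ∀ z z', g z = g z' → flag z < flag z' → F z < F z' := by
    intro z z' he hlt
    refine ⟨⊤, fun o ho => ?_, hlt⟩
    induction o using WithTop.recTopCoe with
    | top => exact absurd ho (lt_irrefl _)
    | coe j => exact congrFun he j
  have hF3 : ∀ z z', g z = g z' → flag z = flag z' → F z = F z' := by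
    intro z z' he h
    simp only [F, he, h]
  have hmax : ∀ z (m : S), (m : Z) ≤ z → (∀ x : S, (x : Z) ≤ z → x ≤ m) → g z = f m := by
    intro z m hm hx
    refine (hg z).unique (IsGreatest.isLUB ⟨⟨m, hm, rfl⟩, ?_⟩)
    rintro _ ⟨x, hxz, rfl⟩
    exact hf.monotone (hx x hxz)
  have hgS : ∀ s : S, g s = f s := fun s => hmax s s le_rfl fun x hx => hx
  have hle : ∀ z (x : S), (x : Z) ≤ z → f x ≤ g z := fun z x hx => (hg z).1 ⟨x, hx, rfl⟩
  have hgm : ∀ z z', z ≤ z' → g z ≤ g z' := by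
    intro z z' h
    refine (hg z).2 ?_
    rintro _ ⟨x, hx, rfl⟩
    exact hle z' x (le_trans hx h)
  have key : ∀ z z', z < z' → (F z ≤ F z') ∧ (z ∈ S ∨ z' ∈ S → F z < F z') := by
    intro z z' hz
    rcases (hgm z z' hz.le).lt_or_eq with h | h
    · exact ⟨(hF1 _ _ h).le, fun _ => hF1 _ _ h⟩
    by_cases hz' : z' ∈ S
    · have hnm : ¬ HasMax z := by
        rintro ⟨m, hm, hx⟩
        have h1 := hmax z m hm hx
        have h2 := hgS ⟨z', hz'⟩
        have h3 : m < ⟨z', hz'⟩ := Subtype.coe_lt_coe.1 (hm.trans_lt hz)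
        exact (hf h3).ne (by rw [← h1, h, ← h2])
      have hzS : z ∉ S := fun hzS => hnm ⟨⟨z, hzS⟩, le_rfl, fun x hx => hx⟩
      have : F z < F z' := hF2 _ _ h (by
        simp only [flag, hzS, hnm, hz', if_true, if_false]; exact iccNegOne_lt_iccZero)
      exact ⟨this.le, fun _ => this⟩
    · have hm' : ∀ m : S, (m : Z) ≤ z → (∀ x : S, (x : Z) ≤ z → x ≤ m) → HasMax z' := by
        intro m hm hx
        refine ⟨m, hm.trans hz.le, fun x hx' => ?_⟩
        have := hle z' x hx'
        rw [← h, hmax z m hm hx] at this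
        exact hf.le_iff_le.1 this
      by_cases hzS : z ∈ S
      · have hM := hm' ⟨z, hzS⟩ le_rfl fun x hx => hx
        have : F z < F z' := hF2 _ _ h (by
          simp only [flag, hzS, hM, hz', if_true, if_false]; exact iccZero_lt_iccOne)
        exact ⟨this.le, fun _ => this⟩
      · refine ⟨?_, fun hor => absurd hor (by tauto)⟩
        by_cases hM : HasMax z
        · have hM' : HasMax z' := by
            obtain ⟨m, hm, hx⟩ := hM
            exact hm' m hm hx
          exact (hF3 _ _ h (by simp only [flag, hzS, hM, hM', hz', if_true, if_false])).le
        · by_cases hM' : HasMax z'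
          · refine (hF2 _ _ h ?_).le
            simp only [flag, hzS, hM, hM', hz', if_true, if_false]
            exact iccNegOne_lt_iccZero.trans iccZero_lt_iccOne
          · exact (hF3 _ _ h (by simp only [flag, hzS, hM, hM', hz', if_false])).le
  refine ⟨WithTop ι, inferInstance, inferInstance, inferInstance, F, ?_, fun z z' h => (key z z' h).2⟩
  intro z z' h
  rcases h.lt_or_eq with h | rfl
  · exact (key z z' h).1
  · exact le_rfl

theorem wellFoundedLT_sigmaLex {κ : Type} {ι : κ → Type} [LinearOrder κ] [WellFoundedLT κ]
    [∀ k, LinearOrder (ι k)] [∀ k, WellFoundedLT (ι k)] : WellFoundedLT (Σₗ k, ι k) := by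
  refine ⟨WellFounded.wellFounded_iff_has_min.2 fun s ⟨p, hp⟩ => ?_⟩
  obtain ⟨k, ⟨i, hi⟩, hk⟩ := (wellFounded_lt (α := κ)).has_min
    {k | ∃ i, (toLex ⟨k, i⟩ : Σₗ k, ι k) ∈ s} ⟨p.1, p.2, hp⟩
  obtain ⟨i, hi, hmin⟩ := (wellFounded_lt (α := ι k)).has_min
    {i | (toLex ⟨k, i⟩ : Σₗ k, ι k) ∈ s} ⟨i, hi⟩
  refine ⟨_, hi, ?_⟩
  rintro ⟨k', j⟩ hj hlt
  rcases Sigma.Lex.lt_def.1 hlt with h | ⟨h, h'⟩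
  · exact hk k' ⟨j, hj⟩ h
  · obtain rfl : k' = k := h
    exact hmin j hj h'

/-- A countable union of sets of countable dimension has countable dimension. -/
theorem HasCountableLexDim.of_cover {Z κ : Type} [LinearOrder Z] [Countable κ] (S : κ → Set Z)
    (hS : ∀ k, HasCountableLexDim (S k)) (hcov : ∀ z, ∃ k, z ∈ S k) : HasCountableLexDim Z := by
  obtain ⟨_, _⟩ := exists_wellFoundedLT κ
  choose ι i₁ i₂ i₃ F hF hsep using fun k => exists_monotone_separating (S k) (hS k)
  have : WellFoundedLT (Σₗ k, ι k) := wellFoundedLT_sigmaLex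
  have : Countable (Σₗ k, ι k) := inferInstanceAs (Countable (Σ k, ι k))
  refine ⟨Σₗ k, ι k, inferInstance, inferInstance, inferInstance,
    fun z => toLex fun p => F (ofLex p).1 z (ofLex p).2, ?_⟩
  intro z z' hz
  obtain ⟨k₀, hk₀⟩ := hcov z
  obtain ⟨k, hk, hmin⟩ := (wellFounded_lt (α := κ)).has_min {k | F k z ≠ F k z'}
    ⟨k₀, (hsep k₀ z z' hz (Or.inl hk₀)).ne⟩
  obtain ⟨i, hi, hlt⟩ := lt_of_le_of_ne (hF k hz.le) hk
  refine ⟨toLex ⟨k, i⟩, ?_, hlt⟩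
  rintro ⟨k', j⟩ hj
  rcases Sigma.Lex.lt_def.1 hj with h | ⟨h, h'⟩
  · have : F k' z = F k' z' := by
      by_contra hne
      exact hmin k' hne h
    exact congrFun this j
  · obtain rfl : k' = k := h
    exact hi j h'

theorem HasCountableLexDim.mono {Z : Type} [LinearOrder Z] {S T : Set Z}
    (hT : HasCountableLexDim T) (h : S ⊆ T) : HasCountableLexDim S :=
  hT.of_strictMono (g := Set.inclusion h) fun _ _ hxy => hxy

theorem HasCountableLexDim.iUnion {Z κ : Type} [LinearOrder Z] [Countable κ] (S : κ → Set Z)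
    (hS : ∀ k, HasCountableLexDim (S k)) : HasCountableLexDim (⋃ k, S k) := by
  refine HasCountableLexDim.of_cover (fun k => {z : ↥(⋃ k, S k) | (z : Z) ∈ S k}) (fun k => ?_)
    fun ⟨z, hz⟩ => by simpa using hz
  exact (hS k).of_strictMono (g := fun z => ⟨z.1.1, z.2⟩) fun _ _ h => h

theorem HasCountableLexDim.union {Z : Type} [LinearOrder Z] {S T : Set Z}
    (hS : HasCountableLexDim S) (hT : HasCountableLexDim T) :
    HasCountableLexDim (S ∪ T : Set Z) := by
  rw [Set.union_eq_iUnion]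
  exact HasCountableLexDim.iUnion _ fun b => by cases b <;> assumption

theorem HasCountableLexDim.of_countable (Z : Type) [LinearOrder Z] [Countable Z] :
    HasCountableLexDim Z :=
  HasCountableLexDim.of_cover (fun z : Z => {z}) (fun _ => .of_subsingleton _) fun z => ⟨z, rfl⟩

/-- A linear order of countable dimension has a countable cofinal subset. -/
theorem HasCountableLexDim.exists_countable_cofinal {Z : Type} [LinearOrder Z]
    (h : HasCountableLexDim Z) : ∃ C : Set Z, C.Countable ∧ ∀ z, ∃ c ∈ C, z ≤ c := by
  classical
  obtain ⟨ι, _, _, _, f, hf⟩ := h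
  by_contra hno
  push Not at hno
  have : Nonempty Z := ⟨(hno ∅ Set.countable_empty).choose⟩
  have hall : ∀ i : ι, ∃ a, ∀ a', a ≤ a' → ∀ j ≤ i, f a' j = f a j := by
    intro i
    induction i using WellFoundedLT.induction with
    | ind i ih =>
      choose! a ha using ih
      obtain ⟨b, hb⟩ := hno (a '' Set.Iio i) (Set.to_countable _ |>.image a)
      have hb' : ∀ b', b ≤ b' → ∀ j < i, f b' j = f b j := by
        intro b' hbb' j hj
        have hlt : a j ≤ b := (hb (a j) ⟨j, hj, rfl⟩).le
        rw [ha j hj b' (hlt.trans hbb') j le_rfl, ha j hj b hlt j le_rfl]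
      by_contra hcon
      push Not at hcon
      have hinc : ∀ b', b ≤ b' → ∃ b'', b' ≤ b'' ∧ f b' i < f b'' i := by
        intro b' hbb'
        obtain ⟨b'', hb'', j, hj, hne⟩ := hcon b'
        refine ⟨b'', hb'', ?_⟩
        have hagree : ∀ j < i, f b' j = f b'' j := fun j hj => by
          rw [hb' b' hbb' j hj, hb' b'' (hbb'.trans hb'') j hj]
        obtain rfl : j = i := by
          by_contra hji
          exact hne (hagree j (lt_of_le_of_ne hj hji)).symm
        exact lt_of_le_of_ne (Pi.apply_le_of_toLex (hf.monotone hb'') hagree) (Ne.symm hne)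
      let P : ℚ → Prop := fun q => ∃ c, b ≤ c ∧ (q : ℝ) < f c i
      obtain ⟨d, hd⟩ := hno (Set.range fun q : ℚ => if h : P q then h.choose else b)
        (Set.countable_range _)
      have hbd : b ≤ d := by
        obtain ⟨q, hq⟩ := exists_rat_gt (1 : ℝ)
        have hP : ¬ P q := by
          rintro ⟨c, -, hc⟩
          exact absurd (f c i).2.2 (not_le.2 (hq.trans hc))
        have := hd _ ⟨q, rfl⟩
        simp only [hP, dif_neg, not_false_eq_true] at this
        exact this.le
      obtain ⟨d', hdd', hlt⟩ := hinc d hbd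
      obtain ⟨q, hq1, hq2⟩ := exists_rat_btwn (Subtype.coe_lt_coe.2 hlt)
      have hP : P q := ⟨d', hbd.trans hdd', hq2⟩
      have hlt' := hd _ ⟨q, rfl⟩
      simp only [hP, dif_pos] at hlt'
      have hsp := hP.choose_spec
      have hle : f hP.choose i ≤ f d i :=
        Pi.apply_le_of_toLex (hf.monotone hlt'.le) fun j hj => by
          rw [hb' _ hsp.1 j hj, hb' d hbd j hj]
      exact absurd (hq1.trans hsp.2) (not_lt.2 hle)
  choose a ha using hall
  obtain ⟨b, hb⟩ := hno (Set.range a) (Set.countable_range a)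
  obtain ⟨c, hc⟩ := hno {b} (Set.countable_singleton b)
  have hbc := hc b rfl
  refine (hf hbc).ne (funext fun i => ?_)
  have hab := (hb (a i) ⟨i, rfl⟩).le
  exact ((ha i c (hab.trans hbc.le) i le_rfl).trans (ha i b hab i le_rfl).symm).symm

theorem HasCountableLexDim.exists_countable_coinitial {Z : Type} [LinearOrder Z]
    (h : HasCountableLexDim Z) : ∃ C : Set Z, C.Countable ∧ ∀ z, ∃ c ∈ C, c ≤ z :=
  h.dual.exists_countable_cofinal

/-- The index set of the coordinates of `LOmegaOne`. -/
abbrev OmegaOneIndex : Type := (ω₁ : Ordinal.{0}).ToType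

theorem exists_strict_bound {S : Set OmegaOneIndex} (hS : S.Countable) :
    ∃ δ : OmegaOneIndex, ∀ i ∈ S, i < δ := by
  have : Countable S := hS.to_subtype
  let f : S → Ordinal.{0} := fun i => Order.succ (Ordinal.ToType.toOrd i.1 : Ordinal)
  have hlim : Order.IsSuccLimit (ω₁ : Ordinal.{0}) := Cardinal.isSuccLimit_omega 1
  have hf : ⨆ i, f i < ω₁ := Ordinal.iSup_lt_omega_one fun i =>
    hlim.succ_lt (Ordinal.ToType.toOrd i.1).2
  refine ⟨Ordinal.ToType.mk ⟨_, hf⟩, fun i hi => ?_⟩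
  rw [← OrderIso.symm_apply_lt (e := Ordinal.ToType.mk), ← Subtype.coe_lt_coe]
  exact lt_of_lt_of_le (Order.lt_succ _) (Ordinal.le_iSup f ⟨i, hi⟩)

theorem countable_Iic_omegaOneIndex (γ : OmegaOneIndex) : (Set.Iic γ).Countable := by
  have h : Cardinal.mk (Set.Iio γ) < (Cardinal.aleph 1) := by
    have h1 := Ordinal.typein_lt_self γ
    have h2 := Cardinal.lt_ord.1 (h1.trans_eq (Cardinal.ord_aleph 1).symm)
    exact h2
  have h' : (Set.Iio γ).Countable := by
    rw [← Cardinal.le_aleph0_iff_set_countable, ← Order.lt_succ_iff, Cardinal.succ_aleph0]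
    exact h
  rw [← Set.Iio_insert]
  exact h'.insert γ

/-- Every countable well-order embeds in `ω₁` above any given point. -/
theorem exists_strictMono_above {ι : Type} [LinearOrder ι] [WellFoundedLT ι] [Countable ι]
    (δ : OmegaOneIndex) : ∃ h : ι → OmegaOneIndex, StrictMono h ∧ ∀ i, δ < h i := by
  choose b hb using fun S : {S : Set OmegaOneIndex // S.Countable} => exists_strict_bound S.2
  let rec' : (i : ι) → ((j : ι) → j < i → OmegaOneIndex) → OmegaOneIndex := fun i r =>
    b ⟨insert δ (Set.range fun j : Set.Iio i => r j j.2), (Set.countable_range _).insert δ⟩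
  let h : ι → OmegaOneIndex := (wellFounded_lt (α := ι)).fix rec'
  have hfix : ∀ i, h i = rec' i fun j _ => h j := (wellFounded_lt (α := ι)).fix_eq rec'
  refine ⟨h, fun j i hji => ?_, fun i => ?_⟩
  · rw [hfix i]
    exact hb _ _ (Or.inr ⟨⟨j, hji⟩, rfl⟩)
  · rw [hfix i]
    exact hb _ _ (Or.inl rfl)

/-- Strictly between two countable subsets `A < B` of `LOmegaOne` there is a cone: the set of all
points with prescribed coordinates up to some `δ`. -/
theorem exists_cone_between {A B : Set LOmegaOne} (hA : A.Countable) (hB : B.Countable)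
    (hAB : ∀ a ∈ A, ∀ b ∈ B, a < b) :
    ∃ (z : OmegaOneIndex → J) (δ : OmegaOneIndex), ∀ y : Lex (OmegaOneIndex → J),
      (∀ i ≤ δ, y i = z i) → (∀ a ∈ A, a.1 < y) ∧ ∀ b ∈ B, y < b.1 := by
  classical
  obtain ⟨δ, hδ⟩ := exists_strict_bound
    (S := ⋃ x ∈ A ∪ B, {i | (ofLex (x : LOmegaOne).1 i : ℝ) ≠ 0})
    ((hA.union hB).biUnion fun x _ => x.2)
  have hzero : ∀ i, ∀ x ∈ A ∪ B, δ ≤ i → x.1 i = iccZero := by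
    intro i x hx hi
    by_contra hne
    exact not_lt.2 hi (hδ i (Set.mem_biUnion hx fun h0 => hne (Subtype.ext h0)))
  obtain ⟨s, hs⟩ := exists_isLUB_lex (Subtype.val '' A)
  have hsA : ∀ a ∈ A, a.1 ≤ s := fun a ha => hs.1 ⟨a, ha, rfl⟩
  have hsB : ∀ b ∈ B, s ≤ b.1 := by
    intro b hb
    refine hs.2 ?_
    rintro _ ⟨a, ha, rfl⟩
    exact (hAB a ha b hb).le
  let t : J := if ∃ a ∈ A, ∀ j < δ, a.1 j = s j then iccOne else iccNegOne
  refine ⟨fun i => if i < δ then s i else t, δ, fun y hy => ?_⟩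
  have hyδ : y δ = t := (hy δ le_rfl).trans (if_neg (lt_irrefl δ))
  have hyj : ∀ j < δ, y j = s j := fun j hj => (hy j hj.le).trans (if_pos hj)
  constructor
  · intro a ha
    by_cases hag : ∀ j < δ, a.1 j = s j
    · refine ⟨δ, fun j hj => (hag j hj).trans (hyj j hj).symm, ?_⟩
      have : t = iccOne := if_pos ⟨a, ha, hag⟩
      change a.1 δ < y δ
      rw [hyδ, this, hzero δ a (Or.inl ha) le_rfl]
      exact iccZero_lt_iccOne
    · have hlt : a.1 < s := lt_of_le_of_ne (hsA a ha) fun h => hag fun j _ => by rw [h]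
      obtain ⟨i, hi, hlt⟩ := hlt
      have hiδ : i < δ := by
        by_contra hge
        exact hag fun j hj => hi j (hj.trans_le (not_lt.1 hge))
      refine ⟨i, fun j hj => (hi j hj).trans (hyj j (hj.trans hiδ)).symm, ?_⟩
      exact hlt.trans_eq (hyj i hiδ).symm
  · intro b hb
    by_cases hag : ∀ j < δ, s j = b.1 j
    · refine ⟨δ, fun j hj => (hyj j hj).trans (hag j hj), ?_⟩
      have : t = iccNegOne := by
        refine if_neg ?_
        rintro ⟨a, ha, haj⟩
        obtain ⟨i, hi, hlt⟩ := hAB a ha b hb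
        rcases lt_or_ge i δ with h | h
        · exact hlt.ne ((haj i h).trans (hag i h))
        · exact hlt.ne ((hzero i a (Or.inl ha) h).trans (hzero i b (Or.inr hb) h).symm)
      change y δ < b.1 δ
      rw [hyδ, this, hzero δ b (Or.inr hb) le_rfl]
      exact iccNegOne_lt_iccZero
    · have hlt : s < b.1 := lt_of_le_of_ne (hsB b hb) fun h => hag fun j _ => by rw [h]
      obtain ⟨i, hi, hlt⟩ := hlt
      have hiδ : i < δ := by
        by_contra hge
        exact hag fun j hj => hi j (hj.trans_le (not_lt.1 hge))
      refine ⟨i, fun j hj => (hyj j (hj.trans hiδ)).trans (hi j hj), ?_⟩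
      exact (hyj i hiδ).trans_lt hlt

theorem HasCountableLexDim.exists_strictMono_between {Z : Type} [LinearOrder Z]
    (hZ : HasCountableLexDim Z) {A B : Set LOmegaOne} (hA : A.Countable) (hB : B.Countable)
    (hAB : ∀ a ∈ A, ∀ b ∈ B, a < b) :
    ∃ e : Z → LOmegaOne, StrictMono e ∧ ∀ z, (∀ a ∈ A, a < e z) ∧ ∀ b ∈ B, e z < b := by
  classical
  obtain ⟨ι, _, _, _, f, hf⟩ := hZ
  obtain ⟨c, δ, hc⟩ := exists_cone_between hA hB hAB
  obtain ⟨h, hh, hδ⟩ := exists_strictMono_above (ι := ι) δ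
  let E : Z → Lex (OmegaOneIndex → J) := fun z => toLex fun i =>
    if i ≤ δ then c i else if hi : ∃ j, h j = i then f z hi.choose else iccZero
  have hEδ : ∀ z, ∀ i ≤ δ, E z i = c i := fun z i hi => if_pos hi
  have hEh : ∀ z j, E z (h j) = f z j := by
    intro z j
    have hex : ∃ j', h j' = h j := ⟨j, rfl⟩
    have : hex.choose = j := hh.injective hex.choose_spec
    change (if h j ≤ δ then c (h j) else
      if hi : ∃ j', h j' = h j then f z hi.choose else iccZero) = _
    rw [if_neg (not_le.2 (hδ j)), dif_pos hex, this]
  have hE0 : ∀ z i, ¬ i ≤ δ → (¬ ∃ j, h j = i) → E z i = iccZero := by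
    intro z i h1 h2
    change (if i ≤ δ then c i else if hi : ∃ j, h j = i then f z hi.choose else iccZero) = _
    rw [if_neg h1, dif_neg h2]
  have hE : ∀ z, E z ∈ LOmegaOne := by
    intro z
    refine ((countable_Iic_omegaOneIndex δ).union (Set.countable_range h)).mono fun i hi => ?_
    by_contra hcon
    rw [Set.mem_union, not_or] at hcon
    exact hi (congrArg Subtype.val (hE0 z i hcon.1 hcon.2))
  refine ⟨fun z => ⟨E z, hE z⟩, fun z z' hz => ?_, fun z => hc (E z) (hEδ z)⟩
  obtain ⟨j, hj, hlt⟩ := hf hz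
  refine ⟨h j, fun i hi => ?_, ?_⟩
  · change E z i = E z' i
    by_cases h1 : i ≤ δ
    · rw [hEδ z i h1, hEδ z' i h1]
    · by_cases h2 : ∃ k, h k = i
      · obtain ⟨k, rfl⟩ := h2
        rw [hEh, hEh]
        exact hj k (hh.lt_iff_lt.1 hi)
      · rw [hE0 z i h1 h2, hE0 z' i h1 h2]
  · change E z (h j) < E z' (h j)
    rw [hEh, hEh]
    exact hlt

/-- Embeddings into `LOmegaOne` extend to larger linear orders of countable dimension. -/
theorem HasCountableLexDim.exists_strictMono_extension {Z : Type} [LinearOrder Z]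
    (hZ : HasCountableLexDim Z) (S : Set Z) (f : S → LOmegaOne) (hf : StrictMono f) :
    ∃ g : Z → LOmegaOne, StrictMono g ∧ ∀ s : S, g s = f s := by
  classical
  have hcut : ∀ A : LowerSet S, ∃ e : Z → LOmegaOne, StrictMono e ∧
      ∀ z, (∀ a ∈ A, f a < e z) ∧ ∀ b ∉ A, e z < f b := by
    intro A
    have hA : HasCountableLexDim {x : S | x ∈ A} :=
      hZ.of_strictMono (g := fun x => x.1.1) fun _ _ h => h
    have hB : HasCountableLexDim {x : S | x ∉ A} :=
      hZ.of_strictMono (g := fun x => x.1.1) fun _ _ h => h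
    obtain ⟨C, hC, hCA⟩ := hA.exists_countable_cofinal
    obtain ⟨D, hD, hDB⟩ := hB.exists_countable_coinitial
    obtain ⟨e, he, hlt⟩ := hZ.exists_strictMono_between
      (hC.image fun x => f x.1) (hD.image fun x => f x.1) (by
        rintro _ ⟨a, -, rfl⟩ _ ⟨b, -, rfl⟩
        exact hf (not_le.1 fun h => b.2 (A.lower h a.2)))
    refine ⟨e, he, fun z => ⟨fun a ha => ?_, fun b hb => ?_⟩⟩
    · obtain ⟨c, hc, hac⟩ := hCA ⟨a, ha⟩
      exact (hf.monotone hac).trans_lt ((hlt z).1 _ ⟨c, hc, rfl⟩)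
    · obtain ⟨d, hd, hdb⟩ := hDB ⟨b, hb⟩
      exact ((hlt z).2 _ ⟨d, hd, rfl⟩).trans_le (hf.monotone hdb)
  choose e he hlt using hcut
  let cut : Z → LowerSet S := fun z => ⟨{x | (x : Z) < z}, fun _ _ hxy hx => lt_of_le_of_lt hxy hx⟩
  let g : Z → LOmegaOne := fun z => if hz : z ∈ S then f ⟨z, hz⟩ else e (cut z) z
  have hgS : ∀ z (hz : z ∈ S), g z = f ⟨z, hz⟩ := fun z hz => dif_pos hz
  have hgn : ∀ z, z ∉ S → g z = e (cut z) z := fun z hz => dif_neg hz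
  refine ⟨g, fun z z' hzz => ?_, fun s => hgS s s.2⟩
  by_cases hz : z ∈ S <;> by_cases hz' : z' ∈ S
  · rw [hgS z hz, hgS z' hz']
    exact hf hzz
  · rw [hgS z hz, hgn z' hz']
    exact (hlt (cut z') z').1 ⟨z, hz⟩ hzz
  · rw [hgn z hz, hgS z' hz']
    exact (hlt (cut z) z).2 ⟨z', hz'⟩ (not_lt.2 hzz.le)
  · rw [hgn z hz, hgn z' hz']
    by_cases hc : cut z = cut z'
    · rw [hc]
      exact he _ hzz
    · have : ∃ x : S, z ≤ x ∧ (x : Z) < z' := by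
        by_contra hcon
        push Not at hcon
        refine hc (LowerSet.ext (Set.ext fun x => ⟨fun h => lt_trans h hzz, fun h => ?_⟩))
        exact not_le.1 fun hx => not_lt.2 (hcon x hx) h
      obtain ⟨x, hx, hx'⟩ := this
      exact ((hlt (cut z) z).2 x (not_lt.2 hx)).trans ((hlt (cut z') z').1 x hx')

/-- The graph of an order isomorphism between two subsets of countable dimension of
`LOmegaOne`. -/
structure IsPartialIso (P : Set (LOmegaOne × LOmegaOne)) : Prop where
  lt_iff : ∀ p ∈ P, ∀ q ∈ P, p.1 < q.1 ↔ p.2 < q.2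
  dim : HasCountableLexDim (Prod.fst '' P)

theorem eq_iff_of_lt_iff {P : Set (LOmegaOne × LOmegaOne)}
    (h : ∀ p ∈ P, ∀ q ∈ P, p.1 < q.1 ↔ p.2 < q.2) {p q : LOmegaOne × LOmegaOne}
    (hp : p ∈ P) (hq : q ∈ P) : p.1 = q.1 ↔ p.2 = q.2 := by
  have h1 := h p hp q hq
  have h2 := h q hq p hp
  rw [eq_iff_le_not_lt, eq_iff_le_not_lt, ← not_lt, ← not_lt, h1, h2]

theorem IsPartialIso.swap {P : Set (LOmegaOne × LOmegaOne)} (h : IsPartialIso P) :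
    IsPartialIso (Prod.swap '' P) where
  lt_iff := by
    rintro _ ⟨p, hp, rfl⟩ _ ⟨q, hq, rfl⟩
    exact (h.lt_iff p hp q hq).symm
  dim := by
    have hex : ∀ y : ↥(Prod.fst '' (Prod.swap '' P)), ∃ p ∈ P, p.2 = y.1 := by
      rintro ⟨_, _, ⟨p, hp, rfl⟩, rfl⟩
      exact ⟨p, hp, rfl⟩
    choose k hk hky using hex
    refine h.dim.of_strictMono (g := fun y => ⟨(k y).1, k y, hk y, rfl⟩) fun y y' hyy => ?_
    change (k y).1 < (k y').1
    rw [h.lt_iff _ (hk y) _ (hk y'), hky, hky]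
    exact hyy

theorem IsPartialIso.exists_extend_domain {P : Set (LOmegaOne × LOmegaOne)} (h : IsPartialIso P)
    {T : Set LOmegaOne} (hT : HasCountableLexDim T) :
    ∃ Q, P ⊆ Q ∧ IsPartialIso Q ∧ T ⊆ Prod.fst '' Q := by
  have hZ := h.dim.union hT
  set Z : Set LOmegaOne := Prod.fst '' P ∪ T with hZdef
  have hex : ∀ x : {x : Z | x.1 ∈ Prod.fst '' P}, ∃ p ∈ P, p.1 = x.1.1 := fun x => x.2
  choose k hk hkx using hex
  obtain ⟨g, hg, hgk⟩ := hZ.exists_strictMono_extension {x : Z | x.1 ∈ Prod.fst '' P}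
    (fun x => (k x).2) fun x x' hxx => by
      rw [← h.lt_iff _ (hk x) _ (hk x'), hkx, hkx]
      exact hxx
  have hfst : Prod.fst '' (Set.range fun z : Z => (z.1, g z)) = Z := by
    rw [← Set.range_comp]
    exact Subtype.range_coe
  refine ⟨Set.range fun z : Z => (z.1, g z), fun p hp => ?_, ⟨?_, ?_⟩, ?_⟩
  · have hpm : p.1 ∈ Prod.fst '' P := ⟨p, hp, rfl⟩
    refine ⟨⟨p.1, Or.inl hpm⟩, Prod.ext rfl ?_⟩
    have h1 := hgk ⟨⟨p.1, Or.inl hpm⟩, hpm⟩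
    exact h1.trans ((eq_iff_of_lt_iff h.lt_iff (hk _) hp).1 (hkx _))
  · rintro _ ⟨z, rfl⟩ _ ⟨z', rfl⟩
    exact (hg.lt_iff_lt (a := z) (b := z')).symm
  · rw [hfst]
    exact hZ
  · rw [hfst]
    exact Set.subset_union_right

theorem IsPartialIso.exists_extend {P : Set (LOmegaOne × LOmegaOne)} (h : IsPartialIso P)
    {T : Set LOmegaOne} (hT : HasCountableLexDim T) :
    ∃ Q, P ⊆ Q ∧ IsPartialIso Q ∧ T ⊆ Prod.fst '' Q ∧ T ⊆ Prod.snd '' Q := by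
  obtain ⟨Q, hPQ, hQ, hTQ⟩ := h.exists_extend_domain hT
  obtain ⟨R, hQR, hR, hTR⟩ := hQ.swap.exists_extend_domain hT
  have hQR' : Q ⊆ Prod.swap '' R := fun p hp => ⟨p.swap, hQR ⟨p, hp, rfl⟩, p.swap_swap⟩
  refine ⟨Prod.swap '' R, hPQ.trans hQR', hR.swap, hTQ.trans (Set.image_mono hQR'), ?_⟩
  rwa [Set.image_image]

theorem lt_iff_of_iUnion {κ : Type} [LinearOrder κ] {P : κ → Set (LOmegaOne × LOmegaOne)}
    (hP : Monotone P) (h : ∀ k, ∀ p ∈ P k, ∀ q ∈ P k, p.1 < q.1 ↔ p.2 < q.2) :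
    ∀ p ∈ ⋃ k, P k, ∀ q ∈ ⋃ k, P k, p.1 < q.1 ↔ p.2 < q.2 := by
  intro p hp q hq
  obtain ⟨k, hk⟩ := Set.mem_iUnion.1 hp
  obtain ⟨l, hl⟩ := Set.mem_iUnion.1 hq
  exact h (max k l) p (hP (le_max_left k l) hk) q (hP (le_max_right k l) hl)

theorem hasCountableLexDim_bounded_support (γ : OmegaOneIndex) :
    HasCountableLexDim {x : LOmegaOne | ∀ i, γ < i → x.1 i = iccZero} := by
  have : Countable (Set.Iic γ) := (countable_Iic_omegaOneIndex γ).to_subtype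
  refine ⟨Set.Iic γ, inferInstance, inferInstance, inferInstance,
    fun x => toLex fun i => x.1.1 i.1, fun x y hxy => ?_⟩
  obtain ⟨i, hi, hlt⟩ := (hxy : x.1.1 < y.1.1)
  have hiγ : i ≤ γ := by
    by_contra hcon
    exact hlt.ne ((x.2 i (not_le.1 hcon)).trans (y.2 i (not_le.1 hcon)).symm)
  exact ⟨⟨i, hiγ⟩, fun j hj => hi j hj, hlt⟩

theorem exists_bounded_support (x : LOmegaOne) :
    ∃ γ, ∀ i, γ < i → x.1 i = iccZero := by
  obtain ⟨γ, hγ⟩ := exists_strict_bound x.2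
  refine ⟨γ, fun i hi => ?_⟩
  by_contra hne
  exact lt_asymm hi (hγ i fun h0 => hne (Subtype.ext h0))

/-- Every isomorphism between subsets of countable dimension is contained in an automorphism. -/
theorem IsPartialIso.exists_orderIso {P : Set (LOmegaOne × LOmegaOne)} (h : IsPartialIso P) :
    ∃ Φ : LOmegaOne ≃o LOmegaOne, ∀ p ∈ P, Φ p.1 = p.2 := by
  classical
  have hstep : ∀ (γ : OmegaOneIndex) (Q : Set (LOmegaOne × LOmegaOne)), ∃ R, Q ⊆ R ∧
      (IsPartialIso Q → IsPartialIso R ∧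
        ∀ x : LOmegaOne, (∀ i, γ < i → x.1 i = iccZero) → x ∈ Prod.fst '' R ∧ x ∈ Prod.snd '' R) := by
    intro γ Q
    by_cases hQ : IsPartialIso Q
    · obtain ⟨R, h1, h2, h3, h4⟩ := hQ.exists_extend (hasCountableLexDim_bounded_support γ)
      exact ⟨R, h1, fun _ => ⟨h2, fun x hx => ⟨h3 hx, h4 hx⟩⟩⟩
    · exact ⟨Q, le_rfl, fun hQ' => absurd hQ' hQ⟩
  choose step hsub hstep using hstep
  let R : OmegaOneIndex → Set (LOmegaOne × LOmegaOne) :=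
    (wellFounded_lt (α := OmegaOneIndex)).fix fun γ r => step γ (P ∪ ⋃ β : Set.Iio γ, r β β.2)
  have hfix : ∀ γ, R γ = step γ (P ∪ ⋃ β : Set.Iio γ, R β) := fun γ =>
    (wellFounded_lt (α := OmegaOneIndex)).fix_eq _ γ
  have hPR : ∀ γ, P ⊆ R γ := fun γ => by
    rw [hfix]
    exact Set.subset_union_left.trans (hsub _ _)
  have hmono : Monotone R := by
    intro β γ hβγ
    rcases hβγ.lt_or_eq with hlt | rfl
    · rw [hfix γ]
      refine Set.Subset.trans (Set.Subset.trans ?_ Set.subset_union_right) (hsub _ _)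
      exact Set.subset_iUnion (fun β : Set.Iio γ => R β) ⟨β, hlt⟩
    · exact le_rfl
  have hgood : ∀ γ, IsPartialIso (P ∪ ⋃ β : Set.Iio γ, R β) ∧ IsPartialIso (R γ) := by
    intro γ
    induction γ using WellFoundedLT.induction with
    | ind γ ih =>
      suffices hU : IsPartialIso (P ∪ ⋃ β : Set.Iio γ, R β) from
        ⟨hU, by rw [hfix]; exact (hstep _ _ hU).1⟩
      have hc : Countable (Set.Iio γ) :=
        ((countable_Iic_omegaOneIndex γ).mono Set.Iio_subset_Iic_self).to_subtype
      by_cases hne : Nonempty (Set.Iio γ)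
      · have hP : P ∪ ⋃ β : Set.Iio γ, R β = ⋃ β : Set.Iio γ, R β := by
          refine Set.union_eq_self_of_subset_left ?_
          obtain ⟨β⟩ := hne
          exact (hPR β).trans (Set.subset_iUnion (fun β : Set.Iio γ => R β) β)
        rw [hP]
        refine ⟨lt_iff_of_iUnion (fun β β' hb => hmono hb) fun β => (ih β β.2).2.lt_iff, ?_⟩
        rw [Set.image_iUnion]
        exact HasCountableLexDim.iUnion _ fun β => (ih β β.2).2.dim
      · rw [not_nonempty_iff] at hne
        rw [Set.iUnion_of_empty, Set.union_empty]
        exact h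
  have hlt := lt_iff_of_iUnion hmono fun γ => (hgood γ).2.lt_iff
  have hcov : ∀ x : LOmegaOne, x ∈ Prod.fst '' (⋃ γ, R γ) ∧ x ∈ Prod.snd '' (⋃ γ, R γ) := by
    intro x
    obtain ⟨γ, hγ⟩ := exists_bounded_support x
    have hx := (hstep γ _ (hgood γ).1).2 x hγ
    rw [← hfix] at hx
    exact ⟨Set.image_mono (Set.subset_iUnion R γ) hx.1, Set.image_mono (Set.subset_iUnion R γ) hx.2⟩
  choose k hk hkx using fun x => (hcov x).1
  have hkeq : ∀ p ∈ ⋃ γ, R γ, (k p.1).2 = p.2 := fun p hp =>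
    (eq_iff_of_lt_iff hlt (hk _) hp).1 (hkx _)
  have hkm : StrictMono fun x => (k x).2 := fun x y hxy => by
    rw [← hlt _ (hk x) _ (hk y), hkx, hkx]
    exact hxy
  have hks : Function.Surjective fun x => (k x).2 := fun y => by
    obtain ⟨p, hp, rfl⟩ := (hcov y).2
    exact ⟨p.1, hkeq p hp⟩
  refine ⟨hkm.orderIsoOfSurjective _ hks, fun p hp => ?_⟩
  obtain ⟨γ⟩ : Nonempty OmegaOneIndex := ⟨(exists_strict_bound Set.countable_empty).choose⟩
  exact hkeq p (Set.mem_iUnion.2 ⟨γ, hPR γ hp⟩)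

theorem HasCountableLexDim.exists_orderIso_extending {X Y : Set LOmegaOne}
    (hX : HasCountableLexDim X) (φ : X ≃o Y) :
    ∃ Φ : LOmegaOne ≃o LOmegaOne, ∀ x : X, Φ (x : LOmegaOne) = φ x := by
  have hP : IsPartialIso (Set.range fun x : X => ((x : LOmegaOne), (φ x : LOmegaOne))) := by
    refine ⟨?_, ?_⟩
    · rintro _ ⟨x, rfl⟩ _ ⟨y, rfl⟩
      exact (φ.lt_iff_lt (x := x) (y := y)).symm
    · refine hX.mono ?_
      rintro _ ⟨_, ⟨x, rfl⟩, rfl⟩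
      exact x.2
  obtain ⟨Φ, hΦ⟩ := hP.exists_orderIso
  exact ⟨Φ, fun x => hΦ _ ⟨x, rfl⟩⟩

theorem hasCountableLexDim_of_iDim_lt {X : Type} [LinearOrder X] (hX : iDim X < ω₁) :
    HasCountableLexDim X := by
  obtain ⟨f, hf⟩ := exists_strictMono_linDim unitInterval X
  have hc : Countable (iDim X).ToType := by
    rw [← Cardinal.mk_le_aleph0_iff, ← Order.lt_succ_iff, Cardinal.succ_aleph0,
      Cardinal.mk_toType]
    exact Cardinal.lt_ord.1 (hX.trans_eq (Cardinal.ord_aleph 1).symm)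
  refine ⟨(iDim X).ToType, inferInstance, inferInstance, hc,
    fun x => toLex fun i => ⟨(f x i : ℝ), by linarith [(f x i).2.1], (f x i).2.2⟩,
    fun x y hxy => ?_⟩
  obtain ⟨i, hi, hlt⟩ := hf hxy
  refine ⟨i, fun j hj => Subtype.ext ?_, hlt⟩
  exact congrArg (fun t : unitInterval => (t : ℝ)) (hi j hj)

theorem proposition8 :
    (∀ X Y : Set LOmegaOne, iDim X < ω₁ → iDim Y < ω₁ →
      ∀ φ : X ≃o Y, ∃ Φ : LOmegaOne ≃o LOmegaOne, ∀ x : X, Φ (x : LOmegaOne) = φ x) ∧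
    (∀ X Y : Set LOmegaOne, X.Countable → Y.Countable →
      ∀ φ : X ≃o Y, ∃ Φ : LOmegaOne ≃o LOmegaOne, ∀ x : X, Φ (x : LOmegaOne) = φ x) := by
  refine ⟨fun X Y hX _ φ => (hasCountableLexDim_of_iDim_lt hX).exists_orderIso_extending φ,
    fun X Y hX _ φ => ?_⟩
  have : Countable X := hX.to_subtype
  exact (HasCountableLexDim.of_countable X).exists_orderIso_extending φ
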